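/- Let $\langle a,b,c,d\rangle$ be the free group on four letters and let $\sigma$ be its endomorphism with $\sigma(a)=aca$, $\sigma(b)=d$, $\sigma(c)=b$, $\sigma(d)=c$. Put $u_k=\sigma^k((ad)^4)$ and $v_k=\sigma^k((adacac)^4)$ for $k\ge 0$, and for $i\ge 0$ let $$\Gamma_i=\langle a,b,c,d \mid a^2=b^2=c^2=d^2=bcd=1,\ u_k=1\ (0\le k\le i),\ v_k=1\ (0\le k<i)\rangle$$ be the $i$-th truncated Lysionok presentation of the first Grigorchuk group. For every integer $n\ge 0$ and for each of the following three properties there exists a group $G$ that has this property, is solvable, and is generated by a set $S$ of exactly three elements, all of order $2$, such that every element of the $n$-ball of $G$ (for the word metric defined by $S$) has finite order: (i) $G$ is infinite and virtually abelian; more precisely, it has a free abelian normal subgroup whose index is finite and a power of $2$; moreover, $G$ is linear (it embeds in $\mathrm{GL}_m(K)$ for some integer $m$ and some field $K$); (ii) $G$ is polycyclic but not virtually nilpotent; (iii) $G$ is not polycyclic. Moreover, in each case $G$ can be chosen to be a quotient of $\Gamma_i$ for some $i\ge 0$ in such a way that the elements of $S$ are images of standard generators of $\Gamma_i$. -/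

import Mathlib

/-! ### The truncated Lysionok presentations of the first Grigorchuk group -/

/-- The four letters `a, b, c, d`. -/
inductive Letter : Type
  | a | b | c | d

namespace Lysionok

open Letter

/-- The free group on `a, b, c, d`. -/
abbrev F : Type := FreeGroup Letter

/-- The letters, as elements of the free group. -/
abbrev gen (x : Letter) : F := FreeGroup.of x

/-- The images of the letters under the substitution
`a ↦ aca`, `b ↦ d`, `c ↦ b`, `d ↦ c`. -/
def substLetter : Letter → F
  | a => gen a * gen c * gen a
  | b => gen d
  | c => gen b
  | d => gen c

/-- The substitution `σ`, extended to an endomorphism of the free group. -/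
def σ : F →* F := FreeGroup.lift substLetter

/-- `u k = σ^k ((ad)^4)`. -/
def u (k : ℕ) : F := (⇑σ)^[k] ((gen a * gen d) ^ 4)

/-- `v k = σ^k ((adacac)^4)`. -/
def v (k : ℕ) : F :=
  (⇑σ)^[k] ((gen a * gen d * gen a * gen c * gen a * gen c) ^ 4)

/-- The relators `a², b², c², d², bcd`. -/
def baseRels : Set F :=
  {gen a ^ 2, gen b ^ 2, gen c ^ 2, gen d ^ 2, gen b * gen c * gen d}

/-- The relators of `Γ i`: the basic ones, `u k` for `k ≤ i` and `v k` for `k < i`. -/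
def rels (i : ℕ) : Set F :=
  baseRels ∪ {r | ∃ k, k ≤ i ∧ r = u k} ∪ {r | ∃ k, k < i ∧ r = v k}

/-- The `i`-th truncated Lysionok group, `i ≥ 0`. -/
abbrev Γ (i : ℕ) : Type := PresentedGroup (rels i)

/-- The set of the standard generators `a, b, c, d` of `Γ i`. -/
def stdGens (i : ℕ) : Set (Γ i) := Set.range PresentedGroup.of

end Lysionok

/-! ### Group-theoretic notions -/

/-- The `n`-ball for the word metric associated with `S`: the products of at most `n`
factors from `S ∪ S⁻¹`. -/
def wordBall {G : Type*} [Group G] (S : Set G) (n : ℕ) : Set G :=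
  {g | ∃ l : List G, l.length ≤ n ∧ (∀ x ∈ l, x ∈ S ∨ x⁻¹ ∈ S) ∧ l.prod = g}

/-- `S` is a generating subset with exactly three elements, all of them of order `2`. -/
def IsInvolutionTriple {G : Type*} [Group G] (S : Set G) : Prop :=
  S.ncard = 3 ∧ (∀ s ∈ S, orderOf s = 2) ∧ Subgroup.closure S = ⊤

/-- A group is virtually abelian if it has an abelian subgroup of finite index. -/
def IsVirtuallyAbelian (G : Type*) [Group G] : Prop :=
  ∃ A : Subgroup G, IsMulCommutative A ∧ A.FiniteIndex

/-- A group is free abelian if it is isomorphic to the free abelian group on some set. -/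
def IsFreeAbelian (G : Type*) [Group G] : Prop :=
  ∃ ι : Type, Nonempty (G ≃* Multiplicative (FreeAbelianGroup ι))

/-- A group is linear if it embeds in `GL_m(K)` for some `m` and some field `K`. -/
def IsLinearGroup (G : Type*) [Group G] : Prop :=
  ∃ (K : Type) (_ : Field K) (m : ℕ) (ρ : G →* Matrix.GeneralLinearGroup (Fin m) K),
    Function.Injective ρ

/-- A group is polycyclic if it has a finite subnormal series
`1 = H 0 ≤ H 1 ≤ ⋯ ≤ H m = G` with cyclic successive quotients. -/
def IsPolycyclic (G : Type*) [Group G] : Prop :=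
  ∃ (m : ℕ) (H : ℕ → Subgroup G), H 0 = ⊥ ∧ H m = ⊤ ∧
    ∀ j < m, H j ≤ H (j + 1) ∧
      ∃ _ : ((H j).subgroupOf (H (j + 1))).Normal,
        IsCyclic (H (j + 1) ⧸ (H j).subgroupOf (H (j + 1)))

/-- The common part of the result: `G` is solvable, it is generated by a set `S` of three elements
of order `2` for which the `n`-ball consists of torsion elements, and it is a quotient of some
`Γ i` in such a way that `S` consists of images of standard generators. -/
def IsTorsionBallQuotient (n : ℕ) (G : Type) [Group G] : Prop :=
  Group.IsSolvable G ∧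
  ∃ S : Set G, IsInvolutionTriple S ∧ (∀ g ∈ wordBall S n, IsOfFinOrder g) ∧
    ∃ (i : ℕ) (π : Lysionok.Γ i →* G), Function.Surjective π ∧ S ⊆ π '' Lysionok.stdGens i

/-! The wreath recursion of the Grigorchuk group, `a ↦ swap`, `b ↦ (a, c)`, `c ↦ (a, d)`, `d ↦ (1,
b)`, turns a homomorphism `f` to `G` that kills the basic relators into `liftHom f`, with values in
`G ≀ ℤ/2`. Two things improve at each application. More Lysionok relators die
(`liftHom_kills_rels`): on the image of `σ` the right coordinate undoes `σ`, while the left one lies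
in the image of `⟨a, d⟩`, a dihedral group of exponent dividing 4. Moreover the recursion contracts:
if words of weight at most `k` have finite order under `f`, words of weight at most `k + 1` have
finite order under `liftHom f` (`liftHom_isOfFinOrder`). Hence, whatever the bottom representation,
sufficiently many applications make the `n`-ball torsion.

The bottom representation `rootHom x s` requires only `s² = 1`, and `x` is arbitrary. As the right
coordinates undo `σ^k`, the group `⟨x, s⟩` survives as a subquotient at every level
(`exists_subquotient`). Solvability, polycyclicity, linearity and being lattice-by-finite pass from
the bottom group to iterated wreath products and their subgroups; the negative properties and
infiniteness are detected in the subquotient. For (i), `x` generates `ℤ` and `s = 1`. For (ii) and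
(iii), `x` is the homothety of ratio `u` and `s` a point reflection of an affine line, with `u = 1 +
√2` over `ℤ[√2]` and `u = 2` over `ℚ`. -/

/-! ### The wreath product with the group of order two -/

/-- The wreath product `G ≀ ℤ/2`: the triple `(l, r, s)` is the pair `(l, r)` followed by the swap
of the two coordinates if `s` is true. -/
@[ext] structure WreathTwo (G : Type) : Type where
  left : G
  right : G
  flip : Bool

namespace WreathTwo

variable {G H : Type} [Group G] [Group H]

instance : Mul (WreathTwo G) :=
  ⟨fun p q => ⟨p.left * cond p.flip q.right q.left, p.right * cond p.flip q.left q.right,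
    xor p.flip q.flip⟩⟩

instance : One (WreathTwo G) := ⟨⟨1, 1, false⟩⟩

instance : Inv (WreathTwo G) :=
  ⟨fun p => ⟨(cond p.flip p.right p.left)⁻¹, (cond p.flip p.left p.right)⁻¹, p.flip⟩⟩

@[simp] theorem mul_left (p q : WreathTwo G) :
    (p * q).left = p.left * cond p.flip q.right q.left := rfl

@[simp] theorem mul_right (p q : WreathTwo G) :
    (p * q).right = p.right * cond p.flip q.left q.right := rfl

@[simp] theorem mul_flip (p q : WreathTwo G) : (p * q).flip = xor p.flip q.flip := rfl

@[simp] theorem one_left : (1 : WreathTwo G).left = 1 := rfl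

@[simp] theorem one_right : (1 : WreathTwo G).right = 1 := rfl

@[simp] theorem one_flip : (1 : WreathTwo G).flip = false := rfl

@[simp] theorem inv_left (p : WreathTwo G) : p⁻¹.left = (cond p.flip p.right p.left)⁻¹ := rfl

@[simp] theorem inv_right (p : WreathTwo G) : p⁻¹.right = (cond p.flip p.left p.right)⁻¹ := rfl

@[simp] theorem inv_flip (p : WreathTwo G) : p⁻¹.flip = p.flip := rfl

instance instGroup : Group (WreathTwo G) :=
  Group.ofLeftAxioms
    (by
      rintro ⟨a, b, s⟩ ⟨c, d, t⟩ ⟨e, f, u⟩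
      cases s <;> cases t <;> ext <;> simp [mul_assoc])
    (by rintro ⟨a, b, s⟩; ext <;> simp)
    (by rintro ⟨a, b, s⟩; cases s <;> ext <;> simp)

/-- The inclusion of the base group. -/
@[simps] def base : G × G →* WreathTwo G where
  toFun p := ⟨p.1, p.2, false⟩
  map_one' := rfl
  map_mul' _ _ := by ext <;> simp

/-- The projection to the group of order two. -/
@[simps] def sign : WreathTwo G →* ℤˣ where
  toFun p := cond p.flip (-1) 1
  map_one' := rfl
  map_mul' p q := by cases hp : p.flip <;> cases hq : q.flip <;> simp [hp, hq]

theorem ker_sign : (sign : WreathTwo G →* ℤˣ).ker = base.range := by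
  ext ⟨a, b, s⟩
  rw [MonoidHom.mem_ker, MonoidHom.mem_range]
  constructor
  · cases s
    · intro _
      exact ⟨(a, b), rfl⟩
    · intro h
      exact absurd (show (-1 : ℤˣ) = 1 from h) (by decide)
  · rintro ⟨p, hp⟩
    rw [← hp]
    rfl

theorem base_injective : Function.Injective (base : G × G →* WreathTwo G) := by
  rintro ⟨a, b⟩ ⟨c, d⟩ h
  exact Prod.ext (congrArg left h) (congrArg right h)

/-- The wreath product is functorial. -/
@[simps] def map (f : G →* H) : WreathTwo G →* WreathTwo H where
  toFun p := ⟨f p.left, f p.right, p.flip⟩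
  map_one' := by ext <;> simp
  map_mul' p q := by cases hp : p.flip <;> ext <;> simp [hp]

/-- The underlying set of the wreath product. -/
def equivProd (G : Type) : WreathTwo G ≃ (G × G) × Bool where
  toFun p := ((p.left, p.right), p.flip)
  invFun q := ⟨q.1.1, q.1.2, q.2⟩
  left_inv _ := rfl
  right_inv _ := rfl

theorem card_eq (G : Type) : Nat.card (WreathTwo G) = Nat.card G * Nat.card G * 2 := by
  rw [Nat.card_congr (equivProd G), Nat.card_prod, Nat.card_prod, Nat.card_eq_fintype_card (α := Bool),
    Fintype.card_bool]

theorem isOfFinOrder_of_flip_false {p : WreathTwo G} (hp : p.flip = false)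
    (hl : IsOfFinOrder p.left) (hr : IsOfFinOrder p.right) : IsOfFinOrder p := by
  have h : p = base (p.left, p.right) := by ext <;> simp [hp]
  rw [h]
  exact MonoidHom.isOfFinOrder _ (hl.prod_mk hr)

theorem isOfFinOrder_of_flip_true {p : WreathTwo G} (hp : p.flip = true)
    (hl : IsOfFinOrder (p.left * p.right)) (hr : IsOfFinOrder (p.right * p.left)) :
    IsOfFinOrder p := by
  refine IsOfFinOrder.of_pow (n := 2) (isOfFinOrder_of_flip_false ?_ ?_ ?_) two_ne_zero
  · simp [pow_two, hp]
  · simpa [pow_two, hp] using hl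
  · simpa [pow_two, hp] using hr

theorem isSolvable (hG : Group.IsSolvable G) : Group.IsSolvable (WreathTwo G) :=
  Group.isSolvable_of_ker_le_range (base : G × G →* WreathTwo G) sign ker_sign.le

end WreathTwo

/-- The `k`-fold iterated wreath product of `G` with groups of order two. -/
def IterWreath (G : Type) : ℕ → Type
  | 0 => G
  | k + 1 => WreathTwo (IterWreath G k)

instance IterWreath.instGroup (G : Type) [hG : Group G] (k : ℕ) : Group (IterWreath G k) :=
  Nat.rec hG (fun k h => @WreathTwo.instGroup (IterWreath G k) h) k

namespace Lysionok

open Letter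

variable {G H : Type} [Group G] [Group H]

/-! ### Lifting representations along the substitution -/

/-- The wreath recursion `a ↦ swap`, `b ↦ (a, c)`, `c ↦ (a, d)`, `d ↦ (1, b)`. -/
def liftLetter (f : F →* G) : Letter → WreathTwo G
  | a => ⟨1, 1, true⟩
  | b => ⟨f (gen a), f (gen c), false⟩
  | c => ⟨f (gen a), f (gen d), false⟩
  | d => ⟨1, f (gen b), false⟩

/-- The homomorphism given by the wreath recursion. -/
def liftHom (f : F →* G) : F →* WreathTwo G := FreeGroup.lift (liftLetter f)

/-- The left coordinates of the images of the letters under `σ`. -/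
def sideLetter : Letter → F
  | a => gen d
  | b => 1
  | c => gen a
  | d => gen a

/-- The endomorphism that gives the left coordinate of the image under `σ`. -/
def side : F →* F := FreeGroup.lift sideLetter

@[simp] theorem liftHom_gen (f : F →* G) (x : Letter) : liftHom f (gen x) = liftLetter f x :=
  FreeGroup.lift_apply_of

@[simp] theorem σ_gen (x : Letter) : σ (gen x) = substLetter x := FreeGroup.lift_apply_of

@[simp] theorem side_gen (x : Letter) : side (gen x) = sideLetter x := FreeGroup.lift_apply_of

/-- `f` kills the basic relators. -/
def KillsBase (f : F →* G) : Prop := ∀ r ∈ baseRels, f r = 1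

theorem killsBase_iff (f : F →* G) : KillsBase f ↔
    (f (gen a) * f (gen a) = 1 ∧ f (gen b) * f (gen b) = 1 ∧ f (gen c) * f (gen c) = 1 ∧
      f (gen d) * f (gen d) = 1 ∧ f (gen b) * f (gen c) * f (gen d) = 1) := by
  simp [KillsBase, baseRels, pow_two]

/-- The right coordinates of `b, c, d` are these letters permuted cyclically, so `bcd` becomes its
conjugate `cdb`; on the left it becomes `a·a·1`. -/
theorem KillsBase.liftHom {f : F →* G} (hf : KillsBase f) : KillsBase (liftHom f) := by
  rw [killsBase_iff] at hf ⊢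
  obtain ⟨ha, hb, hc, hd, hbcd⟩ := hf
  have hcdb : f (gen c) * f (gen d) * f (gen b) = 1 := by
    rw [mul_assoc] at hbcd
    exact mul_eq_one_comm.mp hbcd
  refine ⟨?_, ?_, ?_, ?_, ?_⟩ <;> ext <;> simp [liftLetter, *]

theorem liftHom_σ {f : F →* G} (w : F) :
    Lysionok.liftHom f (σ w) = WreathTwo.base (f (side w), f w) := by
  have h : (Lysionok.liftHom f).comp σ = WreathTwo.base.comp ((f.comp side).prod f) := by
    refine FreeGroup.ext_hom _ _ fun x => ?_
    cases x <;> ext <;> simp [substLetter, sideLetter, liftLetter]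
  exact DFunLike.congr_fun h w

/-- The square of the image of `ad` is `(b, b)`, so the basic relators suffice. -/
theorem liftHom_u_zero {f : F →* G} (hf : KillsBase f) : liftHom f (u 0) = 1 := by
  obtain ⟨ha, hb, hc, hd, hbcd⟩ := (killsBase_iff f).mp hf
  simp only [u, Function.iterate_zero, id_eq, pow_succ, pow_zero, one_mul, map_mul, liftHom_gen]
  ext <;> simp [liftLetter, hb]

/-- The square of the image of `adacac` is `(b, dabad)`, a pair of involutions modulo the basic
relators. -/
theorem liftHom_v_zero {f : F →* G} (hf : KillsBase f) : liftHom f (v 0) = 1 := by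
  obtain ⟨ha, hb, hc, hd, hbcd⟩ := (killsBase_iff f).mp hf
  have ha' (y : G) : f (gen a) * (f (gen a) * y) = y := by rw [← mul_assoc, ha, one_mul]
  have hb' (y : G) : f (gen b) * (f (gen b) * y) = y := by rw [← mul_assoc, hb, one_mul]
  have hd' (y : G) : f (gen d) * (f (gen d) * y) = y := by rw [← mul_assoc, hd, one_mul]
  simp only [v, Function.iterate_zero, id_eq, pow_succ, pow_zero, one_mul, map_mul, liftHom_gen]
  ext <;> simp [liftLetter, mul_assoc, ha, hb, hd, ha', hb', hd']

/-- `side` takes values in `⟨a, d⟩`, whose image is dihedral: its elements are rotations `(AD)^k`,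
killed by the fourth power because `(AD)^4 = 1`, or reflections `(AD)^k A`, which are involutions.
-/
theorem pow_four_side {f : F →* G} (hf : KillsBase f) (hu : f (u 0) = 1) (w : F) :
    f (side w) ^ 4 = 1 := by
  obtain ⟨ha, hb, hc, hd, hbcd⟩ := (killsBase_iff f).mp hf
  set A := f (gen a)
  set D := f (gen d)
  have hA : A⁻¹ = A := inv_eq_of_mul_eq_one_left ha
  have hD : D⁻¹ = D := inv_eq_of_mul_eq_one_left hd
  have hAD : (A * D) ^ 4 = 1 := by simpa [u] using hu
  have hconj (k : ℤ) : A * (A * D) ^ k = (A * D) ^ (-k) * A := by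
    have h : A * (A * D) * A⁻¹ = (A * D)⁻¹ := by
      rw [mul_inv_rev, hA, hD, ← mul_assoc, ha, one_mul]
    have h2 := conj_zpow (a := A) (b := A * D) (i := k)
    rw [h, inv_zpow'] at h2
    rw [h2, inv_mul_cancel_right]
  have key : ∃ k : ℤ, f (side w) = (A * D) ^ k ∨ f (side w) = (A * D) ^ k * A := by
    have mulA (g : G) (h : ∃ k : ℤ, g = (A * D) ^ k ∨ g = (A * D) ^ k * A) :
        ∃ k : ℤ, A * g = (A * D) ^ k ∨ A * g = (A * D) ^ k * A := by
      obtain ⟨k, rfl | rfl⟩ := h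
      · exact ⟨-k, Or.inr (hconj k)⟩
      · exact ⟨-k, Or.inl (by rw [← mul_assoc, hconj, mul_assoc, ha, mul_one])⟩
    have mulAD (g : G) (h : ∃ k : ℤ, g = (A * D) ^ k ∨ g = (A * D) ^ k * A) :
        ∃ k : ℤ, A * D * g = (A * D) ^ k ∨ A * D * g = (A * D) ^ k * A := by
      obtain ⟨k, rfl | rfl⟩ := h
      · exact ⟨k + 1, Or.inl (by rw [add_comm, zpow_add, zpow_one])⟩
      · exact ⟨k + 1, Or.inr (by rw [← mul_assoc, add_comm, zpow_add, zpow_one])⟩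
    have mulD (g : G) (h : ∃ k : ℤ, g = (A * D) ^ k ∨ g = (A * D) ^ k * A) :
        ∃ k : ℤ, D * g = (A * D) ^ k ∨ D * g = (A * D) ^ k * A := by
      have h2 := mulA _ (mulAD g h)
      rwa [mul_assoc A D, ← mul_assoc A A, ha, one_mul] at h2
    have mulLetter (x : Letter) (g : G) (h : ∃ k : ℤ, g = (A * D) ^ k ∨ g = (A * D) ^ k * A) :
        ∃ k : ℤ, f (side (gen x)) * g = (A * D) ^ k ∨ f (side (gen x)) * g = (A * D) ^ k * A := by
      cases x <;> rw [side_gen]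
      · exact mulD g h
      · simpa [sideLetter] using h
      · exact mulA g h
      · exact mulA g h
    have mulLetterInv (x : Letter) (g : G)
        (h : ∃ k : ℤ, g = (A * D) ^ k ∨ g = (A * D) ^ k * A) :
        ∃ k : ℤ, (f (side (gen x)))⁻¹ * g = (A * D) ^ k ∨
          (f (side (gen x)))⁻¹ * g = (A * D) ^ k * A := by
      have : (f (side (gen x)))⁻¹ = f (side (gen x)) := by
        cases x <;> rw [side_gen] <;> simp [sideLetter, A, D, hA, hD]
      rw [this]
      exact mulLetter x g h
    suffices ∀ g : G, (∃ k : ℤ, g = (A * D) ^ k ∨ g = (A * D) ^ k * A) →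
        ∃ k : ℤ, f (side w) * g = (A * D) ^ k ∨ f (side w) * g = (A * D) ^ k * A by
      simpa using this 1 ⟨0, Or.inl (zpow_zero _).symm⟩
    induction w using FreeGroup.induction_on with
    | C1 => intro g hg; simpa using hg
    | of x => exact mulLetter x
    | inv_of x _ => intro g hg; rw [map_inv, map_inv]; exact mulLetterInv x g hg
    | mul x y hx hy => intro g hg; rw [map_mul, map_mul, mul_assoc]; exact hx _ (hy g hg)
  obtain ⟨k, h | h⟩ := key
  · rw [h, ← zpow_natCast, ← zpow_mul, mul_comm, zpow_mul, zpow_natCast, hAD, one_zpow]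
  · have h2 : f (side w) ^ 2 = 1 := by
      rw [h, pow_two, mul_assoc, ← mul_assoc A, hconj, mul_assoc, ha, mul_one, ← zpow_add,
        add_neg_cancel, zpow_zero]
    rw [show 4 = 2 * 2 from rfl, pow_mul, h2, one_pow]

theorem liftHom_σ_pow_four {f : F →* G} (hf : KillsBase f) (hu : f (u 0) = 1) {w : F}
    (hw : f (w ^ 4) = 1) : liftHom f (σ (w ^ 4)) = 1 := by
  rw [liftHom_σ, map_pow side, map_pow f (side w), pow_four_side hf hu, hw]
  rfl

/-- The relators of index `0` die by the basic relations alone; one of index `k + 1` is `σ` of that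
of index `k`, a fourth power already killed by `f`. -/
theorem liftHom_kills_rels {f : F →* G} {i : ℕ} (hf : ∀ r ∈ rels i, f r = 1) :
    ∀ r ∈ rels (i + 1), liftHom f r = 1 := by
  have hbase : KillsBase f := fun r hr => hf r (Or.inl (Or.inl hr))
  have hu (k : ℕ) (hk : k ≤ i) : f (u k) = 1 := hf _ (Or.inl (Or.inr ⟨k, hk, rfl⟩))
  have hv (k : ℕ) (hk : k < i) : f (v k) = 1 := hf _ (Or.inr ⟨k, hk, rfl⟩)
  have step (w : F) (k : ℕ) (hw : f ((σ)^[k] (w ^ 4)) = 1) :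
      liftHom f ((σ)^[k + 1] (w ^ 4)) = 1 := by
    rw [Function.iterate_succ_apply', iterate_map_pow] at *
    exact liftHom_σ_pow_four hbase (hu 0 i.zero_le) hw
  rintro r ((hr | ⟨k, hk, rfl⟩) | ⟨k, hk, rfl⟩)
  · exact hbase.liftHom r hr
  · cases k with
    | zero => exact liftHom_u_zero hbase
    | succ k => exact step _ k (hu k (by omega))
  · cases k with
    | zero => exact liftHom_v_zero hbase
    | succ k => exact step _ k (hv k (by omega))

theorem liftHom_kills_rels_zero {f : F →* G} (hf : KillsBase f) :
    ∀ r ∈ rels 0, liftHom f r = 1 := by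
  rintro r ((hr | ⟨k, hk, rfl⟩) | ⟨k, hk, rfl⟩)
  · exact hf.liftHom r hr
  · obtain rfl : k = 0 := by omega
    exact liftHom_u_zero hf
  · omega

end Lysionok

namespace Lysionok

open Letter

variable {G : Type} [Group G]

/-! ### Contraction and torsion -/

/-- The weights of the letters; the wreath recursion strictly contracts the weight of a pair
consisting of `a` and another letter. -/
def weight : Letter → ℕ
  | a => 3
  | b => 3
  | c => 2
  | d => 1

/-- The weight of a word. -/
def wordWeight (w : List Letter) : ℕ := (w.map weight).sum

/-- The image of a word. -/
def evalWord (f : F →* G) (w : List Letter) : G := (w.map fun x => f (gen x)).prod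

@[simp] theorem evalWord_nil (f : F →* G) : evalWord f [] = 1 := rfl

@[simp] theorem evalWord_cons (f : F →* G) (x : Letter) (w : List Letter) :
    evalWord f (x :: w) = f (gen x) * evalWord f w := by
  simp [evalWord]

@[simp] theorem evalWord_append (f : F →* G) (w w' : List Letter) :
    evalWord f (w ++ w') = evalWord f w * evalWord f w' := by
  simp [evalWord]

@[simp] theorem wordWeight_nil : wordWeight [] = 0 := rfl

@[simp] theorem wordWeight_cons (x : Letter) (w : List Letter) :
    wordWeight (x :: w) = weight x + wordWeight w := by
  simp [wordWeight]

@[simp] theorem wordWeight_append (w w' : List Letter) :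
    wordWeight (w ++ w') = wordWeight w + wordWeight w' := by
  simp [wordWeight]

/-- The elements of the four-group `{1, b, c, d}`. -/
inductive Klein : Type
  | e | b | c | d

namespace Klein

/-- The element of the free group that represents an element of the four-group. -/
def toFree : Klein → F
  | e => 1
  | b => gen Letter.b
  | c => gen Letter.c
  | d => gen Letter.d

/-- The multiplication of the four-group. -/
def mul : Klein → Klein → Klein
  | e, y => y
  | x, e => x
  | b, b => e
  | c, c => e
  | d, d => e
  | b, c => d
  | c, b => d
  | b, d => c
  | d, b => c
  | c, d => b
  | d, c => b

/-- The weight of an element of the four-group. -/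
def weight : Klein → ℕ
  | e => 0
  | b => 3
  | c => 2
  | d => 1

/-- The left section of an element of the four-group. -/
def leftSection : Klein → List Letter
  | e => []
  | b => [Letter.a]
  | c => [Letter.a]
  | d => []

/-- The right section of an element of the four-group. -/
def rightSection : Klein → List Letter
  | e => []
  | b => [Letter.c]
  | c => [Letter.d]
  | d => [Letter.b]

theorem weight_mul_le (x y : Klein) : (mul x y).weight ≤ x.weight + y.weight := by
  cases x <;> cases y <;> simp [mul, weight]

theorem map_mul {f : F →* G} (hf : KillsBase f) (x y : Klein) :
    f (mul x y).toFree = f x.toFree * f y.toFree := by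
  obtain ⟨-, hb, hc, hd, hbcd⟩ := (killsBase_iff f).mp hf
  have hb' : (f (gen Letter.b))⁻¹ = f (gen Letter.b) := inv_eq_of_mul_eq_one_left hb
  have hc' : (f (gen Letter.c))⁻¹ = f (gen Letter.c) := inv_eq_of_mul_eq_one_left hc
  have hd' : (f (gen Letter.d))⁻¹ = f (gen Letter.d) := inv_eq_of_mul_eq_one_left hd
  have h1 : f (gen Letter.b) * f (gen Letter.c) = f (gen Letter.d) := by
    rw [← hd']; exact eq_inv_of_mul_eq_one_left hbcd
  have h2 : f (gen Letter.c) * f (gen Letter.b) = f (gen Letter.d) := by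
    rw [← hd', ← h1, mul_inv_rev, hb', hc']
  have h3 : f (gen Letter.b) * f (gen Letter.d) = f (gen Letter.c) := by
    rw [← h1, ← mul_assoc, hb, one_mul]
  have h4 : f (gen Letter.d) * f (gen Letter.b) = f (gen Letter.c) := by
    rw [← h2, mul_assoc, hb, mul_one]
  have h5 : f (gen Letter.c) * f (gen Letter.d) = f (gen Letter.b) := by
    rw [← h2, ← mul_assoc, hc, one_mul]
  have h6 : f (gen Letter.d) * f (gen Letter.c) = f (gen Letter.b) := by
    rw [← h1, mul_assoc, hc, mul_one]
  cases x <;> cases y <;> simp [mul, toFree, *]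

theorem isOfFinOrder {f : F →* G} (hf : KillsBase f) (x : Klein) : IsOfFinOrder (f x.toFree) := by
  rw [isOfFinOrder_iff_pow_eq_one]
  refine ⟨2, two_pos, ?_⟩
  rw [pow_two, ← map_mul hf]
  cases x <;> simp [mul, toFree]

theorem liftHom_toFree (f : F →* G) (x : Klein) :
    liftHom f x.toFree = ⟨evalWord f x.leftSection, evalWord f x.rightSection, false⟩ := by
  cases x <;> ext <;> simp [toFree, leftSection, rightSection, liftLetter]

/-- The weights are chosen for this strict inequality: each syllable `xa` loses at least one unit of
weight. -/
theorem weight_sections (x : Klein) :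
    wordWeight x.leftSection + wordWeight x.rightSection < x.weight + 3 := by
  cases x <;> simp [leftSection, rightSection, weight, Lysionok.weight]

end Klein

/-- The image of `(x₁ a) ⋯ (xₖ a)`. -/
def evalSyllables (f : F →* G) (l : List Klein) : G :=
  (l.map fun x => f x.toFree * f (gen a)).prod

@[simp] theorem evalSyllables_nil (f : F →* G) : evalSyllables f [] = 1 := rfl

@[simp] theorem evalSyllables_cons (f : F →* G) (x : Klein) (l : List Klein) :
    evalSyllables f (x :: l) = f x.toFree * f (gen a) * evalSyllables f l := by
  simp [evalSyllables]

/-- The weight of `(x₁ a) ⋯ (xₖ a)`. -/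
def syllableWeight (l : List Klein) : ℕ := (l.map fun x => x.weight + 3).sum

@[simp] theorem syllableWeight_nil : syllableWeight [] = 0 := rfl

@[simp] theorem syllableWeight_cons (x : Klein) (l : List Klein) :
    syllableWeight (x :: l) = x.weight + 3 + syllableWeight l := by
  simp [syllableWeight]

theorem exists_mul_syllables {f : F →* G} (hf : KillsBase f) (x : Klein) (l : List Klein)
    (y : Klein) : ∃ (l' : List Klein) (y' : Klein),
      f x.toFree * (evalSyllables f l * f y.toFree) = evalSyllables f l' * f y'.toFree ∧
      syllableWeight l' + y'.weight ≤ x.weight + (syllableWeight l + y.weight) := by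
  cases l with
  | nil =>
    exact ⟨[], x.mul y, by simp [Klein.map_mul hf], by simpa using Klein.weight_mul_le x y⟩
  | cons z l =>
    refine ⟨x.mul z :: l, y, by simp [Klein.map_mul hf, mul_assoc], ?_⟩
    have := Klein.weight_mul_le x z
    simp only [syllableWeight_cons]
    omega

/-- Adjacent letters among `b, c, d` are merged in the four-group; the weight does not grow because
each of 3, 2, 1 is at most the sum of the other two. -/
theorem exists_syllables {f : F →* G} (hf : KillsBase f) (w : List Letter) :
    ∃ (l : List Klein) (y : Klein), evalWord f w = evalSyllables f l * f y.toFree ∧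
      syllableWeight l + y.weight ≤ wordWeight w := by
  induction w with
  | nil => exact ⟨[], .e, by simp [Klein.toFree], by simp [Klein.weight]⟩
  | cons x w ih =>
    obtain ⟨l, y, hw, hl⟩ := ih
    have key (z : Klein) (hz : z.toFree = gen x) (hz' : z.weight = weight x) :
        ∃ (l : List Klein) (y : Klein), evalWord f (x :: w) = evalSyllables f l * f y.toFree ∧
          syllableWeight l + y.weight ≤ wordWeight (x :: w) := by
      obtain ⟨l', y', h1, h2⟩ := exists_mul_syllables hf z l y
      refine ⟨l', y', by rw [evalWord_cons, hw, ← hz, h1], ?_⟩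
      rw [wordWeight_cons]
      omega
    cases x with
    | a =>
      refine ⟨.e :: l, y, by simp [hw, Klein.toFree, mul_assoc], ?_⟩
      rw [syllableWeight_cons, wordWeight_cons, show Klein.weight .e = 0 from rfl,
        show weight a = 3 from rfl]
      omega
    | b => exact key .b rfl rfl
    | c => exact key .c rfl rfl
    | d => exact key .d rfl rfl

/-- The two sections of `(x₁ a) ⋯ (xₖ a)`. -/
def sections : List Klein → List Letter × List Letter
  | [] => ([], [])
  | x :: l => (x.leftSection ++ (sections l).2, x.rightSection ++ (sections l).1)

theorem weight_sections_le (l : List Klein) :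
    wordWeight (sections l).1 + wordWeight (sections l).2 ≤ syllableWeight l := by
  induction l with
  | nil => simp [sections]
  | cons x l ih =>
    have := x.weight_sections
    simp only [sections, wordWeight_append, syllableWeight_cons]
    omega

theorem liftHom_syllables (f : F →* G) (l : List Klein) :
    (evalSyllables (liftHom f) l).left = evalWord f (sections l).1 ∧
      (evalSyllables (liftHom f) l).right = evalWord f (sections l).2 := by
  induction l with
  | nil => simp [sections]
  | cons x l ih => simp [sections, Klein.liftHom_toFree, liftLetter, ih]

theorem isOfFinOrder_mul_comm {x y : G} (h : IsOfFinOrder (x * y)) : IsOfFinOrder (y * x) := by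
  have := (MulAut.conj y).toMonoidHom.isOfFinOrder h
  simpa [mul_assoc] using this

/-- Up to conjugacy the word is a product of syllables, whose sections have smaller total weight.
Without a swap both sections are torsion; with a swap the square has the two products of the
sections as coordinates, still of small weight. -/
theorem liftHom_isOfFinOrder {f : F →* G} (hf : KillsBase f) {k : ℕ}
    (h : ∀ w, wordWeight w ≤ k → IsOfFinOrder (evalWord f w)) (w : List Letter)
    (hw : wordWeight w ≤ k + 1) : IsOfFinOrder (evalWord (liftHom f) w) := by
  obtain ⟨l, y, hly, hl⟩ := exists_syllables hf.liftHom w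
  rw [hly]
  cases l with
  | nil => simpa using Klein.isOfFinOrder hf.liftHom y
  | cons x l =>
    refine isOfFinOrder_mul_comm ?_
    -- The trailing four-group letter is moved to the front by conjugation and absorbed in the first
    -- syllable.
    have hyx : liftHom f y.toFree * evalSyllables (liftHom f) (x :: l) =
        evalSyllables (liftHom f) (y.mul x :: l) := by
      simp [Klein.map_mul hf.liftHom, mul_assoc]
    rw [hyx]
    have h1 := Klein.weight_mul_le y x
    have h2 := (y.mul x).weight_sections
    have h3 := weight_sections_le l
    -- The strict loss comes from the first syllable; for the others the weak inequality is enough.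
    have hlt : wordWeight (sections (y.mul x :: l)).1 + wordWeight (sections (y.mul x :: l)).2
        ≤ k := by
      simp only [sections, wordWeight_append, syllableWeight_cons] at *
      omega
    obtain ⟨e1, e2⟩ := liftHom_syllables f (y.mul x :: l)
    cases hs : (evalSyllables (liftHom f) (y.mul x :: l)).flip
    · exact WreathTwo.isOfFinOrder_of_flip_false hs (e1 ▸ h _ (by omega)) (e2 ▸ h _ (by omega))
    · refine WreathTwo.isOfFinOrder_of_flip_true hs ?_ ?_
      · rw [e1, e2, ← evalWord_append]
        exact h _ (by rw [wordWeight_append]; omega)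
      · rw [e1, e2, ← evalWord_append]
        exact h _ (by rw [wordWeight_append]; omega)

/-! ### The tower of representations -/

/-- The images of the letters at the bottom of the tower. -/
def rootLetter (x s : G) : Letter → WreathTwo G
  | a => ⟨x, x⁻¹, true⟩
  | b => ⟨1, 1, true⟩
  | c => ⟨s, s, true⟩
  | d => ⟨s, s, false⟩

/-- The representation at the bottom of the tower. -/
def rootHom (x s : G) : F →* WreathTwo G := FreeGroup.lift (rootLetter x s)

@[simp] theorem rootHom_gen (x s : G) (y : Letter) : rootHom x s (gen y) = rootLetter x s y :=
  FreeGroup.lift_apply_of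

theorem rootHom_killsBase {x s : G} (hs : s * s = 1) : KillsBase (rootHom x s) := by
  rw [killsBase_iff]
  refine ⟨?_, ?_, ?_, ?_, ?_⟩ <;> ext <;> simp [rootLetter, hs]

/-- The tower of representations obtained from the bottom one by the wreath recursion. -/
def towerHom (x s : G) : ∀ k, F →* IterWreath G (k + 1)
  | 0 => rootHom x s
  | k + 1 => liftHom (towerHom x s k)

theorem towerHom_killsBase {x s : G} (hs : s * s = 1) : ∀ k, KillsBase (towerHom x s k)
  | 0 => rootHom_killsBase hs
  | k + 1 => (towerHom_killsBase hs k).liftHom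

/-- The bottom representation is only known to kill the basic relators, hence the shift by one: the
first lift gains `u 0`, and each further lift gains one more `u` and one more `v`. -/
theorem towerHom_kills_rels {x s : G} (hs : s * s = 1) :
    ∀ i, ∀ r ∈ rels i, towerHom x s (i + 1) r = 1
  | 0 => liftHom_kills_rels_zero (towerHom_killsBase hs 0)
  | i + 1 => liftHom_kills_rels (towerHom_kills_rels hs i)

theorem towerHom_isOfFinOrder {x s : G} (hs : s * s = 1) :
    ∀ k w, wordWeight w ≤ k → IsOfFinOrder (evalWord (towerHom x s k) w)
  | 0, [], _ => IsOfFinOrder.one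
  | 0, y :: w, h => by cases y <;> simp [weight] at h
  | k + 1, w, h => liftHom_isOfFinOrder (towerHom_killsBase hs k) (towerHom_isOfFinOrder hs k) w h

/-- The letter `a` swaps after one lift; `a` is the left coordinate of `b` and `c`, and `b` the
right coordinate of `d`. Thus three lifts make all four letters nontrivial. -/
theorem towerHom_a_ne_one (x s : G) (k : ℕ) : towerHom x s (k + 1) (gen a) ≠ 1 := fun h =>
  Bool.noConfusion (congrArg WreathTwo.flip ((liftHom_gen (towerHom x s k) a).symm.trans h))

theorem towerHom_b_ne_one (x s : G) (k : ℕ) : towerHom x s (k + 2) (gen b) ≠ 1 := fun h =>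
  towerHom_a_ne_one x s k
    (congrArg WreathTwo.left ((liftHom_gen (towerHom x s (k + 1)) b).symm.trans h))

theorem towerHom_c_ne_one (x s : G) (k : ℕ) : towerHom x s (k + 2) (gen c) ≠ 1 := fun h =>
  towerHom_a_ne_one x s k
    (congrArg WreathTwo.left ((liftHom_gen (towerHom x s (k + 1)) c).symm.trans h))

theorem towerHom_d_ne_one (x s : G) (k : ℕ) : towerHom x s (k + 3) (gen d) ≠ 1 := fun h =>
  towerHom_b_ne_one x s k
    (congrArg WreathTwo.right ((liftHom_gen (towerHom x s (k + 2)) d).symm.trans h))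

theorem towerHom_a_ne (x s : G) (k : ℕ) (y : Letter) (hy : y ≠ a) :
    towerHom x s (k + 1) (gen a) ≠ towerHom x s (k + 1) (gen y) := by
  intro h
  have h2 := (liftHom_gen (towerHom x s k) a).symm.trans
    (h.trans (liftHom_gen (towerHom x s k) y))
  have h3 := congrArg WreathTwo.flip h2
  cases y
  · exact hy rfl
  all_goals exact Bool.noConfusion h3

/-- The `k`-th group of the tower. -/
abbrev TowerGroup (x s : G) (k : ℕ) : Type := (towerHom x s k).range

/-- A word of length `n` has weight at most `3n`; the three additional levels ensure `d ≠ 1`, that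
is, `b ≠ c`. -/
theorem isTorsionBallQuotient_tower {x s : G} (hs : s * s = 1) (n : ℕ)
    (hG : Group.IsSolvable (TowerGroup x s (3 * n + 3))) :
    IsTorsionBallQuotient n (TowerGroup x s (3 * n + 3)) := by
  set f := (towerHom x s (3 * n + 3)).rangeRestrict
  have hkill : KillsBase f := fun r hr => Subtype.ext (towerHom_killsBase hs _ r hr)
  obtain ⟨ha, hb, hc, hd, hbcd⟩ := (killsBase_iff f).mp hkill
  have hsurj : Function.Surjective f := (towerHom x s (3 * n + 3)).rangeRestrict_surjective
  have hne (w w' : F) (h : towerHom x s (3 * n + 3) w ≠ towerHom x s (3 * n + 3) w') :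
      f w ≠ f w' := fun h' => h (congrArg Subtype.val h')
  have hone (w : F) (h : towerHom x s (3 * n + 3) w ≠ 1) : f w ≠ 1 :=
    fun h' => h (congrArg Subtype.val h')
  have hbc : f (gen b) ≠ f (gen c) := by
    intro h
    refine hone (gen d) (towerHom_d_ne_one x s (3 * n)) ?_
    rwa [h, hc, one_mul] at hbcd
  have hmem : ∀ g ∈ ({f (gen a), f (gen b), f (gen c)} : Set _),
      ∃ y : Letter, f (gen y) = g ∧ g ≠ 1 ∧ g * g = 1 := by
    rintro g (rfl | rfl | rfl)
    · exact ⟨a, rfl, hone _ (towerHom_a_ne_one x s _), ha⟩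
    · exact ⟨b, rfl, hone _ (towerHom_b_ne_one x s _), hb⟩
    · exact ⟨c, rfl, hone _ (towerHom_c_ne_one x s _), hc⟩
  refine ⟨hG, {f (gen a), f (gen b), f (gen c)}, ⟨?_, ?_, ?_⟩, ?_, ?_⟩
  · rw [Set.ncard_eq_three]
    exact ⟨_, _, _, hne _ _ (towerHom_a_ne x s _ b (by simp)),
      hne _ _ (towerHom_a_ne x s _ c (by simp)), hbc, rfl⟩
  · intro g hg
    obtain ⟨-, -, h1, h2⟩ := hmem g hg
    exact orderOf_eq_prime (by rw [pow_two, h2]) h1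
  · rw [eq_top_iff]
    rintro g -
    obtain ⟨w, rfl⟩ := hsurj g
    set T := Subgroup.closure ({f (gen a), f (gen b), f (gen c)} : Set _)
    have hTa : f (gen a) ∈ T := Subgroup.subset_closure (by simp)
    have hTb : f (gen b) ∈ T := Subgroup.subset_closure (by simp)
    have hTc : f (gen c) ∈ T := Subgroup.subset_closure (by simp)
    have hTd : f (gen d) ∈ T := by
      rw [eq_inv_of_mul_eq_one_right hbcd]
      exact T.inv_mem (T.mul_mem hTb hTc)
    have hT (y : Letter) : f (gen y) ∈ T := by cases y <;> assumption
    induction w using FreeGroup.induction_on with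
    | C1 => simp
    | of y => exact hT y
    | inv_of y _ => rw [map_inv]; exact T.inv_mem (hT y)
    | mul y z hy hz => rw [map_mul]; exact T.mul_mem hy hz
  · rintro g ⟨l, hl, hS, rfl⟩
    have hword : ∃ w : List Letter, w.length = l.length ∧ evalWord f w = l.prod := by
      clear hl
      induction l with
      | nil => exact ⟨[], rfl, rfl⟩
      | cons g l ih =>
        obtain ⟨w, hw, hw'⟩ := ih fun z hz => hS z (List.mem_cons_of_mem _ hz)
        have : ∃ y : Letter, f (gen y) = g := by
          rcases hS g List.mem_cons_self with h | h
          · obtain ⟨y, hy, -⟩ := hmem _ h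
            exact ⟨y, hy⟩
          · obtain ⟨y, hy, -, h2⟩ := hmem _ h
            refine ⟨y, ?_⟩
            rw [hy]
            have := inv_eq_of_mul_eq_one_left h2
            rwa [inv_inv, eq_comm] at this
        obtain ⟨y, rfl⟩ := this
        exact ⟨y :: w, by simp [hw], by simp [hw']⟩
    obtain ⟨w, hw, hw'⟩ := hword
    have hle (w : List Letter) : wordWeight w ≤ 3 * w.length := by
      induction w with
      | nil => simp
      | cons y w ih =>
        have : weight y ≤ 3 := by cases y <;> simp [weight]
        simp only [wordWeight_cons, List.length_cons]
        omega
    rw [← hw', ← (Subgroup.subtype_injective _).isOfFinOrder_iff]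
    have h := towerHom_isOfFinOrder (x := x) hs (3 * n + 3) w ((hle w).trans (by omega))
    convert h using 1
    simp only [evalWord, map_list_prod, List.map_map]
    rfl
  · have hlift : FreeGroup.lift (fun y => f (gen y)) = f :=
      FreeGroup.ext_hom _ _ fun y => by simp
    have hrel : ∀ r ∈ rels (3 * n + 2), FreeGroup.lift (fun y => f (gen y)) r = 1 := by
      intro r hr
      rw [hlift]
      exact Subtype.ext (towerHom_kills_rels hs (3 * n + 2) r hr)
    refine ⟨3 * n + 2, PresentedGroup.toGroup hrel, ?_, ?_⟩
    · intro g
      obtain ⟨w, rfl⟩ := hsurj g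
      exact ⟨PresentedGroup.mk _ w, DFunLike.congr_fun hlift w⟩
    · intro g hg
      obtain ⟨y, rfl, -⟩ := hmem g hg
      exact ⟨PresentedGroup.of y, ⟨y, rfl⟩, PresentedGroup.toGroup.of hrel⟩

/-! ### The bottom group as a subquotient -/

/-- A pair of words in the four letters: `ab` and `d`. -/
def pairHom : FreeGroup Bool →* F :=
  FreeGroup.lift fun t => cond t (gen a * gen b) (gen d)

/-- The homomorphism from the free group on two letters with given images. -/
def markHom (x s : G) : FreeGroup Bool →* G := FreeGroup.lift fun t => cond t x s

@[simp] theorem markHom_true (x s : G) : markHom x s (FreeGroup.of true) = x :=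
  FreeGroup.lift_apply_of

@[simp] theorem markHom_false (x s : G) : markHom x s (FreeGroup.of false) = s :=
  FreeGroup.lift_apply_of

/-- The swaps in `a` and `b` cancel, leaving `ab ↦ (x, x⁻¹)` and `d ↦ (s, s)` in the base group. -/
theorem rootHom_pairHom (x s : G) (w : FreeGroup Bool) :
    rootHom x s (pairHom w) = WreathTwo.base (markHom x s w, markHom x⁻¹ s w) := by
  have h : (rootHom x s).comp pairHom =
      WreathTwo.base.comp ((markHom x s).prod (markHom x⁻¹ s)) := by
    refine FreeGroup.ext_hom _ _ fun t => ?_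
    cases t <;> ext <;> simp [pairHom, rootLetter]
  exact DFunLike.congr_fun h w

theorem towerHom_σ (x s : G) (k : ℕ) (w : F) (h : towerHom x s k ((σ)^[k] w) = 1) :
    rootHom x s w = 1 := by
  induction k with
  | zero => exact h
  | succ k ih =>
    rw [Function.iterate_succ_apply'] at h
    have h2 := (liftHom_σ (f := towerHom x s k) ((σ)^[k] w)).symm.trans h
    exact ih (congrArg WreathTwo.right h2)

/-- The words `σ^k(ab)` and `σ^k(d)` generate a subgroup of the tower group that maps onto `⟨x, s⟩`:
take right coordinates `k` times, then the left coordinate at the bottom. -/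
theorem exists_subquotient (x s : G) (k : ℕ) :
    ∃ h : FreeGroup Bool →* TowerGroup x s k, h.ker ≤ (markHom x s).ker := by
  have iter : ∀ k, ∃ τ : F →* F, ∀ w, τ w = (σ)^[k] w := by
    intro k
    induction k with
    | zero => exact ⟨MonoidHom.id F, fun w => rfl⟩
    | succ k ih =>
      obtain ⟨τ, hτ⟩ := ih
      exact ⟨σ.comp τ, fun w => by rw [Function.iterate_succ_apply', ← hτ]; rfl⟩
  obtain ⟨τ, hτ⟩ := iter k
  refine ⟨((towerHom x s k).rangeRestrict.comp τ).comp pairHom, fun w hw => ?_⟩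
  have h1 : towerHom x s k (τ (pairHom w)) = 1 := congrArg Subtype.val (MonoidHom.mem_ker.mp hw)
  rw [hτ] at h1
  have h2 := (rootHom_pairHom x s w).symm.trans (towerHom_σ x s k _ h1)
  exact congrArg WreathTwo.left h2

end Lysionok

/-! ### Polycyclic groups -/

section Polycyclic

variable {G H Q : Type} [Group G] [Group H] [Group Q]

/-- `K` is the kernel of a homomorphism from `K'` to a cyclic group. -/
def IsCyclicStep (K K' : Subgroup G) : Prop :=
  K ≤ K' ∧ ∃ (C : Type) (_ : Group C) (_ : IsCyclic C) (θ : K' →* C), θ.ker = K.subgroupOf K'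

/-- Kernels of homomorphisms to cyclic groups are easier to pull back and push forward than
quotients. -/
theorem isCyclicStep_iff (K K' : Subgroup G) : IsCyclicStep K K' ↔ K ≤ K' ∧
    ∃ _ : (K.subgroupOf K').Normal, IsCyclic (K' ⧸ K.subgroupOf K') := by
  refine and_congr_right fun _ => ⟨?_, ?_⟩
  · rintro ⟨C, _, _, θ, hθ⟩
    generalize K.subgroupOf K' = N at hθ
    subst hθ
    exact ⟨inferInstance, isCyclic_of_injective _ (QuotientGroup.kerLift_injective θ)⟩
  · rintro ⟨_, h⟩
    exact ⟨_, inferInstance, h, QuotientGroup.mk' _, QuotientGroup.ker_mk' _⟩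

theorem IsCyclicStep.comap {K K' : Subgroup H} (h : IsCyclicStep K K') (f : G →* H) :
    IsCyclicStep (K.comap f) (K'.comap f) := by
  obtain ⟨hle, C, _, hC, θ, hθ⟩ := h
  refine ⟨Subgroup.comap_mono hle, C, inferInstance, hC, θ.comp (f.subgroupComap K'), ?_⟩
  rw [← MonoidHom.comap_ker, hθ]
  rfl

theorem IsCyclicStep.map {K K' : Subgroup G} (h : IsCyclicStep K K') {f : G →* H}
    (hf : Function.Injective f) : IsCyclicStep (K.map f) (K'.map f) := by
  obtain ⟨hle, C, _, hC, θ, hθ⟩ := h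
  let e := K'.equivMapOfInjective f hf
  refine ⟨Subgroup.map_mono hle, C, inferInstance, hC, θ.comp e.symm.toMonoidHom, ?_⟩
  rw [← MonoidHom.comap_ker, hθ]
  ext x
  obtain ⟨y, rfl⟩ := e.surjective x
  have : ((e y : K'.map f) : H) = f y := rfl
  simp [Subgroup.mem_subgroupOf, this, hf.eq_iff]

/-- `K'` is obtained from `K` by finitely many cyclic extensions. -/
inductive IsPolycyclicOver (K : Subgroup G) : Subgroup G → Prop
  | refl : IsPolycyclicOver K K
  | step {K' K'' : Subgroup G} :
      IsPolycyclicOver K K' → IsCyclicStep K' K'' → IsPolycyclicOver K K''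

theorem IsPolycyclicOver.trans {K K' K'' : Subgroup G} (h : IsPolycyclicOver K K')
    (h' : IsPolycyclicOver K' K'') : IsPolycyclicOver K K'' := by
  induction h' with
  | refl => exact h
  | step _ hs ih => exact ih.step hs

theorem IsPolycyclicOver.comap {K K' : Subgroup H} (h : IsPolycyclicOver K K') (f : G →* H) :
    IsPolycyclicOver (K.comap f) (K'.comap f) := by
  induction h with
  | refl => exact .refl
  | step _ hs ih => exact ih.step (hs.comap f)

theorem IsPolycyclicOver.map {K K' : Subgroup G} (h : IsPolycyclicOver K K') {f : G →* H}
    (hf : Function.Injective f) : IsPolycyclicOver (K.map f) (K'.map f) := by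
  induction h with
  | refl => exact .refl
  | step _ hs ih => exact ih.step (hs.map hf)

theorem isPolycyclic_iff : IsPolycyclic G ↔ IsPolycyclicOver (⊥ : Subgroup G) ⊤ := by
  constructor
  · rintro ⟨m, H, h0, hm, hs⟩
    have : ∀ j ≤ m, IsPolycyclicOver (⊥ : Subgroup G) (H j) := by
      intro j
      induction j with
      | zero => intro _; rw [h0]; exact .refl
      | succ j ih =>
        intro hj
        exact (ih (by omega)).step ((isCyclicStep_iff _ _).mpr (hs j (by omega)))
    exact hm ▸ this m le_rfl
  · suffices ∀ K : Subgroup G, IsPolycyclicOver ⊥ K → ∃ (m : ℕ) (H : ℕ → Subgroup G), H 0 = ⊥ ∧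
        H m = K ∧ ∀ j < m, IsCyclicStep (H j) (H (j + 1)) by
      intro h
      obtain ⟨m, H, h0, hm, hs⟩ := this ⊤ h
      exact ⟨m, H, h0, hm, fun j hj => (isCyclicStep_iff _ _).mp (hs j hj)⟩
    intro K hK
    induction hK with
    | refl => exact ⟨0, fun _ => ⊥, rfl, rfl, fun j hj => absurd hj (by omega)⟩
    | @step K' K'' _ h' ih =>
      obtain ⟨m, H, h0, hm, hs⟩ := ih
      refine ⟨m + 1, fun j => if j ≤ m then H j else K'', by simp [h0], by simp, fun j hj => ?_⟩
      rcases Nat.lt_succ_iff_lt_or_eq.mp hj with hlt | rfl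
      · simpa [hlt.le, Nat.succ_le_of_lt hlt] using hs j hlt
      · simpa [hm] using h'

theorem IsPolycyclic.of_injective (hH : IsPolycyclic H) {f : G →* H}
    (hf : Function.Injective f) : IsPolycyclic G := by
  rw [isPolycyclic_iff] at *
  have := hH.comap f
  rwa [Subgroup.comap_top, MonoidHom.comap_bot, (MonoidHom.ker_eq_bot_iff f).mpr hf] at this

theorem IsPolycyclic.of_extension (hH : IsPolycyclic H) (hQ : IsPolycyclic Q) {f : H →* G}
    (hf : Function.Injective f) {g : G →* Q} (hg : g.ker = f.range) : IsPolycyclic G := by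
  rw [isPolycyclic_iff] at *
  have h1 := hH.map hf
  have h2 := hQ.comap g
  rw [Subgroup.map_bot, ← MonoidHom.range_eq_map] at h1
  rw [Subgroup.comap_top, MonoidHom.comap_bot, hg] at h2
  exact h1.trans h2

theorem isPolycyclic_of_isCyclic (G : Type) [Group G] [hG : IsCyclic G] : IsPolycyclic G := by
  rw [isPolycyclic_iff]
  refine IsPolycyclicOver.refl.step ⟨bot_le, G, inferInstance, hG, (⊤ : Subgroup G).subtype, ?_⟩
  ext x
  simp

theorem IsPolycyclic.prod (hG : IsPolycyclic G) (hH : IsPolycyclic H) : IsPolycyclic (G × H) := by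
  refine IsPolycyclic.of_extension hG hH (f := MonoidHom.inl G H) (g := MonoidHom.snd G H)
    (fun x y h => congrArg Prod.fst h) ?_
  ext ⟨x, y⟩
  simp [Subgroup.mem_prod, eq_comm]

theorem IsPolycyclic.wreathTwo (hG : IsPolycyclic G) : IsPolycyclic (WreathTwo G) :=
  IsPolycyclic.of_extension (hG.prod hG) (isPolycyclic_of_isCyclic ℤˣ) WreathTwo.base_injective
    WreathTwo.ker_sign

/-- In a cyclic step, `P` is generated by `P ⊓ K'` and one element `t` lifting a generator of the
cyclic image of `P`. -/
theorem IsPolycyclicOver.fg {K : Subgroup G} (h : IsPolycyclicOver ⊥ K) :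
    ∀ P ≤ K, P.FG := by
  induction h with
  | refl =>
    intro P hP
    rw [le_bot_iff.mp hP]
    exact Subgroup.FG.bot
  | @step K' K'' _ hs ih =>
    intro P hP
    obtain ⟨hle, C, _, hC, θ, hθ⟩ := hs
    let η : P →* C := θ.comp (Subgroup.inclusion hP)
    have : IsCyclic η.range := inferInstance
    obtain ⟨⟨_, t, rfl⟩, ht⟩ := this.exists_generator
    have hfg : (P ⊓ K' ⊔ Subgroup.closure {(t : G)}).FG :=
      (ih _ inf_le_right).sup ⟨{(t : G)}, by simp⟩
    convert hfg
    apply le_antisymm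
    · intro g hg
      obtain ⟨z, hz⟩ := ht ⟨η ⟨g, hg⟩, ⟨g, hg⟩, rfl⟩
      have hz' : η t ^ z = η ⟨g, hg⟩ := congrArg Subtype.val hz
      have hker : η (⟨g, hg⟩ * (t ^ z)⁻¹) = 1 := by
        rw [map_mul, map_inv, map_zpow, hz', mul_inv_cancel]
      have hK' : g * ((t : G) ^ z)⁻¹ ∈ K' := by
        have h2 : Subgroup.inclusion hP (⟨g, hg⟩ * (t ^ z)⁻¹) ∈ θ.ker := hker
        rw [hθ, Subgroup.mem_subgroupOf] at h2
        simpa using h2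
      rw [← inv_mul_cancel_right g ((t : G) ^ z), ← inv_inv ((t : G) ^ z)]
      refine Subgroup.mul_mem_sup ⟨?_, ?_⟩ ?_
      · exact P.mul_mem (by simpa using hg) (P.inv_mem (by simpa using P.zpow_mem t.2 z))
      · simpa using hK'
      · simpa using Subgroup.zpow_mem _ (Subgroup.mem_closure_singleton_self (t : G)) z
    · refine sup_le inf_le_left ?_
      rw [Subgroup.closure_le]
      simp

theorem IsPolycyclic.fg (hG : IsPolycyclic G) (P : Subgroup G) : P.FG :=
  (isPolycyclic_iff.mp hG).fg P le_top

end Polycyclic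

theorem IterWreath.isPolycyclic {G : Type} [Group G] (hG : IsPolycyclic G) :
    ∀ k, IsPolycyclic (IterWreath G k)
  | 0 => hG
  | k + 1 => (IterWreath.isPolycyclic hG k).wreathTwo

theorem IterWreath.isSolvable {G : Type} [Group G] (hG : Group.IsSolvable G) :
    ∀ k, Group.IsSolvable (IterWreath G k)
  | 0 => hG
  | k + 1 => WreathTwo.isSolvable (IterWreath.isSolvable hG k)

/-! ### Groups that are free abelian by a finite `2`-group -/

/-- `G` has a homomorphism to a finite `2`-group with free abelian kernel of finite rank. -/
def IsLatticeByTwo (G : Type) [Group G] : Prop :=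
  ∃ (P : Type) (_ : Group P) (k : ℕ) (θ : G →* P) (A : Type) (_ : AddCommGroup A)
    (_ : Module.Finite ℤ A) (_ : Module.Free ℤ A) (ι : θ.ker →* Multiplicative A),
    Nat.card P = 2 ^ k ∧ Function.Injective ι

/-- The kernel of `WreathTwo.map θ` is `θ.ker × θ.ker` without swaps, which embeds in `A × A`. -/
theorem IsLatticeByTwo.wreathTwo {G : Type} [Group G] (h : IsLatticeByTwo G) :
    IsLatticeByTwo (WreathTwo G) := by
  obtain ⟨P, _, k, θ, A, _, _, _, ι, hP, hι⟩ := h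
  have hker (p : (WreathTwo.map θ).ker) :
      p.1.left ∈ θ.ker ∧ p.1.right ∈ θ.ker ∧ p.1.flip = false := by
    have := MonoidHom.mem_ker.mp p.2
    exact ⟨congrArg WreathTwo.left this, congrArg WreathTwo.right this,
      congrArg WreathTwo.flip this⟩
  let ι' : (WreathTwo.map θ).ker →* Multiplicative (A × A) :=
    { toFun := fun p => Multiplicative.ofAdd ((ι ⟨_, (hker p).1⟩).toAdd,
        (ι ⟨_, (hker p).2.1⟩).toAdd)
      map_one' := by
        apply Multiplicative.toAdd.injective
        exact Prod.ext (congrArg Multiplicative.toAdd ι.map_one)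
          (congrArg Multiplicative.toAdd ι.map_one)
      map_mul' := fun p q => by
        apply Multiplicative.toAdd.injective
        refine Prod.ext ?_ ?_
        · refine congrArg Multiplicative.toAdd
            ((congrArg ι (Subtype.ext ?_)).trans
              (ι.map_mul ⟨_, (hker p).1⟩ ⟨_, (hker q).1⟩))
          simp [(hker p).2.2]
        · refine congrArg Multiplicative.toAdd
            ((congrArg ι (Subtype.ext ?_)).trans
              (ι.map_mul ⟨_, (hker p).2.1⟩ ⟨_, (hker q).2.1⟩))
          simp [(hker p).2.2] }
  refine ⟨WreathTwo P, inferInstance, 2 * k + 1, WreathTwo.map θ, A × A, inferInstance,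
    inferInstance, inferInstance, ι', ?_, fun p q h => ?_⟩
  · rw [WreathTwo.card_eq, hP]
    ring
  · have h2 := congrArg Multiplicative.toAdd h
    have hl : ι ⟨_, (hker p).1⟩ = ι ⟨_, (hker q).1⟩ := congrArg Prod.fst h2
    have hr : ι ⟨_, (hker p).2.1⟩ = ι ⟨_, (hker q).2.1⟩ := congrArg Prod.snd h2
    refine Subtype.ext (WreathTwo.ext (congrArg Subtype.val (hι hl))
      (congrArg Subtype.val (hι hr)) ?_)
    rw [(hker p).2.2, (hker q).2.2]

theorem IsLatticeByTwo.iterWreath {G : Type} [Group G] (hG : IsLatticeByTwo G) :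
    ∀ k, IsLatticeByTwo (IterWreath G k)
  | 0 => hG
  | k + 1 => (IsLatticeByTwo.iterWreath hG k).wreathTwo

theorem IsLatticeByTwo.subgroup {G : Type} [Group G] (h : IsLatticeByTwo G) (H : Subgroup G) :
    IsLatticeByTwo H := by
  obtain ⟨P, _, k, θ, A, _, _, _, ι, hP, hι⟩ := h
  have hle (p : (θ.comp H.subtype).ker) : (p.1 : G) ∈ θ.ker := p.2
  let j : (θ.comp H.subtype).ker →* θ.ker :=
    (H.subtype.comp (θ.comp H.subtype).ker.subtype).codRestrict θ.ker hle
  refine ⟨P, inferInstance, k, θ.comp H.subtype, A, inferInstance, inferInstance, inferInstance,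
    ι.comp j, hP, hι.comp fun p q h => ?_⟩
  exact Subtype.ext (Subtype.ext (congrArg (fun z : θ.ker => (z : G)) h))

/-- A subgroup of a free `ℤ`-module of finite rank is free, and the index of the kernel is the order
of a subgroup of a 2-group. -/
theorem IsLatticeByTwo.exists_isFreeAbelian {G : Type} [Group G] (h : IsLatticeByTwo G) :
    ∃ A : Subgroup G, A.Normal ∧ IsFreeAbelian A ∧ ∃ k : ℕ, A.index = 2 ^ k := by
  obtain ⟨P, _, k, θ, A, _, _, _, ι, hP, hι⟩ := h
  refine ⟨θ.ker, inferInstance, ?_, ?_⟩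
  · let B : Submodule ℤ A := AddSubgroup.toIntSubmodule (Subgroup.toAddSubgroup' ι.range)
    let e1 : θ.ker ≃* ι.range := ι.ofInjective hι
    obtain ⟨n, b⟩ := Submodule.basisOfPid (Module.Free.chooseBasis ℤ A) B
    let e2 : B ≃+ FreeAbelianGroup (Fin n) :=
      b.repr.toAddEquiv.trans (FreeAbelianGroup.equivFinsupp (Fin n)).symm
    exact ⟨Fin n, ⟨e1.trans
      { toFun := fun p => Multiplicative.ofAdd (e2 ⟨p.1.toAdd, p.2⟩)
        invFun := fun q => ⟨Multiplicative.ofAdd (e2.symm q.toAdd).1, (e2.symm q.toAdd).2⟩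
        left_inv := fun p => by simp
        right_inv := fun q => by simp
        map_mul' := fun p q => congrArg Multiplicative.ofAdd
          (e2.map_add ⟨p.1.toAdd, p.2⟩ ⟨q.1.toAdd, q.2⟩) }⟩⟩
  · rw [Subgroup.index_ker]
    obtain ⟨j, -, hj⟩ := (Nat.dvd_prime_pow Nat.prime_two).mp (hP ▸ θ.range.card_subgroup_dvd_card)
    exact ⟨j, hj⟩

theorem isVirtuallyAbelian_of_isFreeAbelian {G : Type} [Group G] {A : Subgroup G}
    (hA : IsFreeAbelian A) (hi : A.index ≠ 0) : IsVirtuallyAbelian G := by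
  obtain ⟨ι, ⟨e⟩⟩ := hA
  exact ⟨A, ⟨⟨fun x y => e.injective (by rw [map_mul, map_mul, mul_comm])⟩⟩, ⟨hi⟩⟩

/-! ### Linear groups -/

/-- `G` acts faithfully and linearly on a non-zero vector space of finite dimension over `ℚ`. -/
def HasFaithfulRep (G : Type) [Group G] : Prop :=
  ∃ (V : Type) (_ : AddCommGroup V) (_ : Module ℚ V) (_ : FiniteDimensional ℚ V)
    (_ : Nontrivial V) (ρ : G →* Module.End ℚ V), Function.Injective ρ

/-- This is the induced representation on `V × V`. Nontriviality of `V` is needed to tell a swap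
from the identity, by means of a vector `(0, v₀)`. -/
theorem HasFaithfulRep.wreathTwo {G : Type} [Group G] (h : HasFaithfulRep G) :
    HasFaithfulRep (WreathTwo G) := by
  obtain ⟨V, _, _, _, _, ρ, hρ⟩ := h
  let τ (t : Bool) : Module.End ℚ (V × V) :=
    cond t ((LinearMap.snd ℚ V V).prod (LinearMap.fst ℚ V V)) 1
  let ρ' : WreathTwo G →* Module.End ℚ (V × V) :=
    { toFun := fun p => ((ρ p.left).prodMap (ρ p.right)) * τ p.flip
      map_one' := by ext <;> simp [τ]
      map_mul' := fun p q => by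
        refine LinearMap.ext fun v => ?_
        cases hp : p.flip <;> cases hq : q.flip <;> simp [τ, hp, hq] }
  refine ⟨V × V, inferInstance, inferInstance, inferInstance, inferInstance, ρ', ?_⟩
  obtain ⟨v₀, hv₀⟩ := exists_ne (0 : V)
  have hne (g : G) : ρ g v₀ ≠ 0 := by
    intro h
    apply hv₀
    have h2 : (ρ g⁻¹ * ρ g) v₀ = 0 := by rw [Module.End.mul_apply, h, map_zero]
    rwa [← map_mul, inv_mul_cancel, map_one, Module.End.one_apply] at h2
  rw [injective_iff_map_eq_one]
  intro p hp
  have key (v : V × V) : ρ' p v = v := by rw [hp]; rfl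
  have happ (v : V × V) : ρ' p v = (ρ p.left (τ p.flip v).1, ρ p.right (τ p.flip v).2) := rfl
  cases hf : p.flip
  · refine WreathTwo.ext (hρ ?_) (hρ ?_) hf
    · ext v
      have := congrArg Prod.fst ((happ (v, v)).symm.trans (key (v, v)))
      simpa [τ, hf] using this
    · ext v
      have := congrArg Prod.snd ((happ (v, v)).symm.trans (key (v, v)))
      simpa [τ, hf] using this
  · have := congrArg Prod.fst ((happ (0, v₀)).symm.trans (key (0, v₀)))
    exact absurd (by simpa [τ, hf] using this) (hne p.left)

theorem HasFaithfulRep.iterWreath {G : Type} [Group G] (hG : HasFaithfulRep G) :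
    ∀ k, HasFaithfulRep (IterWreath G k)
  | 0 => hG
  | k + 1 => (HasFaithfulRep.iterWreath hG k).wreathTwo

theorem HasFaithfulRep.subgroup {G : Type} [Group G] (h : HasFaithfulRep G) (H : Subgroup G) :
    HasFaithfulRep H := by
  obtain ⟨V, i1, i2, i3, i4, ρ, hρ⟩ := h
  exact ⟨V, i1, i2, i3, i4, ρ.comp H.subtype, hρ.comp H.subtype_injective⟩

theorem HasFaithfulRep.isLinearGroup {G : Type} [Group G] (h : HasFaithfulRep G) :
    IsLinearGroup G := by
  obtain ⟨V, _, _, _, _, ρ, hρ⟩ := h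
  let e := (LinearMap.toMatrixAlgEquiv (Module.finBasis ℚ V)).toMulEquiv
  refine ⟨ℚ, inferInstance, Module.finrank ℚ V, ((e.toMonoidHom).comp ρ).toHomUnits, ?_⟩
  intro g g' hg
  exact hρ (e.injective (congrArg Units.val hg))

open scoped commutatorElement

/-! ### Affine groups -/

/-- The semidirect product of the additive group of `R` with a group that acts on it through units
of `R`. -/
@[ext] structure AffineExtension {R U : Type} [CommRing R] [Group U] (χ : U →* Rˣ) : Type where
  trans : R
  lin : U

namespace AffineExtension

variable {R U : Type} [CommRing R] [Group U] {χ : U →* Rˣ}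

instance : Mul (AffineExtension χ) := ⟨fun p q => ⟨p.trans + χ p.lin * q.trans, p.lin * q.lin⟩⟩

instance : One (AffineExtension χ) := ⟨⟨0, 1⟩⟩

instance : Inv (AffineExtension χ) := ⟨fun p => ⟨-((χ p.lin)⁻¹ : Rˣ) * p.trans, p.lin⁻¹⟩⟩

@[simp] theorem mul_trans (p q : AffineExtension χ) :
    (p * q).trans = p.trans + χ p.lin * q.trans := rfl

@[simp] theorem mul_lin (p q : AffineExtension χ) : (p * q).lin = p.lin * q.lin := rfl

@[simp] theorem one_trans : (1 : AffineExtension χ).trans = 0 := rfl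

@[simp] theorem one_lin : (1 : AffineExtension χ).lin = 1 := rfl

@[simp] theorem inv_trans (p : AffineExtension χ) :
    p⁻¹.trans = -((χ p.lin)⁻¹ : Rˣ) * p.trans := rfl

@[simp] theorem inv_lin (p : AffineExtension χ) : p⁻¹.lin = p.lin⁻¹ := rfl

instance : Group (AffineExtension χ) :=
  Group.ofLeftAxioms
    (fun p q r => by ext <;> simp [mul_assoc, mul_add, add_assoc])
    (fun p => by ext <;> simp)
    (fun p => by ext <;> simp)

/-- The inclusion of the translations. -/
@[simps] def transHom : Multiplicative R →* AffineExtension χ where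
  toFun v := ⟨v.toAdd, 1⟩
  map_one' := rfl
  map_mul' v w := by ext <;> simp

/-- The linear part. -/
@[simps] def linHom : AffineExtension χ →* U where
  toFun p := p.lin
  map_one' := rfl
  map_mul' _ _ := rfl

theorem transHom_injective : Function.Injective (transHom (χ := χ)) := fun _ _ h =>
  congrArg trans h

theorem ker_linHom : (linHom (χ := χ)).ker = (transHom (χ := χ)).range := by
  ext p
  rw [MonoidHom.mem_ker, MonoidHom.mem_range]
  constructor
  · intro h
    exact ⟨Multiplicative.ofAdd p.trans, AffineExtension.ext rfl h.symm⟩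
  · rintro ⟨v, rfl⟩
    rfl

theorem isSolvable (hU : Group.IsSolvable U) : Group.IsSolvable (AffineExtension χ) :=
  Group.isSolvable_of_ker_le_range (transHom (χ := χ)) linHom ker_linHom.le

theorem isPolycyclic (hR : IsPolycyclic (Multiplicative R)) (hU : IsPolycyclic U) :
    IsPolycyclic (AffineExtension χ) :=
  hR.of_extension hU transHom_injective ker_linHom

theorem commutator_transHom (v : R) (p : AffineExtension χ) :
    ⁅transHom (χ := χ) (Multiplicative.ofAdd v), p⁆ =
      transHom (Multiplicative.ofAdd ((1 - (χ p.lin : R)) * v)) := by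
  ext
  · simp [commutatorElement_def]
    ring
  · simp [commutatorElement_def]

end AffineExtension

/-- The action of `ℤ × {±1}` on `R` through the powers of a unit and the signs. -/
def signedPowers {R : Type} [CommRing R] (u : Rˣ) : Multiplicative ℤ × ℤˣ →* Rˣ :=
  (zpowersHom Rˣ u).coprod (Units.map (Int.castRingHom R).toMonoidHom)

namespace AffineExtension

variable {R : Type} [CommRing R] (u : Rˣ)

/-- The homothety of ratio `u`. -/
def homothety : AffineExtension (signedPowers u) := ⟨0, (Multiplicative.ofAdd 1, 1)⟩

/-- The point reflection `y ↦ 1 - y`. -/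
def reflection : AffineExtension (signedPowers u) := ⟨1, (1, -1)⟩

theorem coe_signedPowers_homothety : (signedPowers u (homothety u).lin : R) = u := by
  simp [signedPowers, homothety]

theorem coe_signedPowers_reflection : (signedPowers u (reflection u).lin : R) = -1 := by
  simp [signedPowers, reflection]

theorem reflection_mul_self : reflection u * reflection u = 1 := by
  ext
  · rw [mul_trans, coe_signedPowers_reflection]
    simp [reflection]
  · rfl
  · rfl

theorem commutator_reflection_homothety :
    ⁅reflection u, homothety u⁆ = transHom (Multiplicative.ofAdd (1 - (u : R))) := by
  have h : (reflection u)⁻¹ = reflection u :=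
    inv_eq_of_mul_eq_one_left (reflection_mul_self u)
  rw [commutatorElement_def, h]
  refine AffineExtension.ext ?_ ?_
  · change _ = 1 - (u : R)
    simp only [mul_trans, mul_lin, map_mul, Units.val_mul, coe_signedPowers_reflection,
      coe_signedPowers_homothety]
    simp [reflection, homothety]
    ring
  · change _ = (1 : Multiplicative ℤ × ℤˣ)
    simp [reflection, homothety]

theorem homothety_pow_lin (m : ℕ) :
    (signedPowers u (homothety u ^ m).lin : R) = (u : R) ^ m := by
  have h : (homothety u ^ m).lin = (homothety u).lin ^ m :=
    map_pow (linHom (χ := signedPowers u)) (homothety u) m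
  rw [h, map_pow, Units.val_pow_eq_pow_val, coe_signedPowers_homothety]

end AffineExtension

/-! ### Properties detected in a subquotient -/

section Subquotient

open Lysionok AffineExtension

variable {G : Type} [Group G]

theorem infinite_of_subquotient {h : FreeGroup Bool →* G}
    (hh : h.ker ≤ (markHom (Multiplicative.ofAdd (1 : ℤ)) 1).ker) : Infinite G := by
  refine Infinite.of_injective (fun z : ℤ => h (FreeGroup.of true ^ z)) fun z z' hz => ?_
  have h1 : FreeGroup.of true ^ (z - z') ∈ h.ker := by
    rw [MonoidHom.mem_ker, zpow_sub, map_mul, map_inv]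
    exact mul_inv_eq_one.mpr hz
  have h2 := MonoidHom.mem_ker.mp (hh h1)
  rw [map_zpow, markHom_true, ← ofAdd_zsmul] at h2
  have h3 : (z - z') • (1 : ℤ) = 0 := congrArg Multiplicative.toAdd h2
  rw [smul_eq_mul, mul_one] at h3
  omega

/-- Commutation with the `m`-th power of the homothety multiplies a translation by `1 - u^m`,
nonzero because `u > 1` in `ℝ`. Iterated commutators inside a finite-index subgroup therefore never
vanish. -/
theorem not_isVirtuallyNilpotent_of_subquotient {R : Type} [CommRing R] {u : Rˣ} (g : R →+* ℝ)
    (hu : 1 < g u) {h : FreeGroup Bool →* G}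
    (hh : h.ker ≤ (markHom (homothety u) (reflection u)).ker) :
    ¬ Group.IsVirtuallyNilpotent G := by
  rintro ⟨N, hN, hfin⟩
  obtain ⟨c, hc⟩ := (Subgroup.isNilpotent_iff_lowerCentralSeries N).mp hN
  set x : FreeGroup Bool := FreeGroup.of true
  set y : FreeGroup Bool := ⁅FreeGroup.of false, x⁆
  have hy : markHom (homothety u) (reflection u) y =
      transHom (Multiplicative.ofAdd (1 - (u : R))) := by
    rw [map_commutatorElement, markHom_false, markHom_true, commutator_reflection_homothety]
  -- Positive powers of the homothety and of a nontrivial translation lie in `N`.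
  obtain ⟨m, hm, -, hmN⟩ := Subgroup.exists_pow_mem_of_index_ne_zero hfin.index_ne_zero (h x)
  obtain ⟨l, hl, -, hlN⟩ := Subgroup.exists_pow_mem_of_index_ne_zero hfin.index_ne_zero (h y)
  have key : ∀ k, ∃ w : FreeGroup Bool, h w ∈ N.lowerCentralSeries k ∧
      markHom (homothety u) (reflection u) w =
        transHom (Multiplicative.ofAdd ((1 - (u : R) ^ m) ^ k * (l * (1 - (u : R))))) := by
    intro k
    induction k with
    | zero =>
      refine ⟨y ^ l, by rw [map_pow]; exact hlN, ?_⟩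
      rw [map_pow, hy, ← map_pow, ← ofAdd_nsmul, nsmul_eq_mul, pow_zero, one_mul]
    | succ k ih =>
      obtain ⟨w, hw, hw'⟩ := ih
      refine ⟨⁅w, x ^ m⁆, ?_, ?_⟩
      · rw [map_commutatorElement, map_pow, Subgroup.lowerCentralSeries_succ]
        exact Subgroup.commutator_mem_commutator hw hmN
      · rw [map_commutatorElement, hw', map_pow, markHom_true, commutator_transHom,
          homothety_pow_lin, ← mul_assoc, ← pow_succ']
  obtain ⟨w, hw, hw'⟩ := key c
  rw [hc, Subgroup.mem_bot] at hw
  have h1 := (MonoidHom.mem_ker.mp (hh hw)).symm.trans hw'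
  have h2 : (1 - (u : R) ^ m) ^ c * (l * (1 - (u : R))) = 0 :=
    (congrArg AffineExtension.trans h1).symm
  have h3 := congrArg g h2
  simp only [map_mul, map_pow, map_sub, map_one, map_natCast, map_zero] at h3
  have h4 : 1 < g u ^ m := one_lt_pow₀ hu hm.ne'
  refine mul_ne_zero (pow_ne_zero _ (by linarith)) (mul_ne_zero ?_ (by linarith)) h3
  exact_mod_cast hl.ne'

/-- Otherwise the subgroup of translations would be finitely generated, so its elements would have a
common denominator; but conjugation by the homothety of ratio 2 produces every denominator `2^M`. -/
theorem not_isPolycyclic_of_subquotient {h : FreeGroup Bool →* G} {u : ℚˣ} (hu : (u : ℚ) = 2)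
    (hh : h.ker ≤ (markHom (homothety u) (reflection u)).ker) : ¬ IsPolycyclic G := by
  intro hG
  set e := markHom (homothety u) (reflection u)
  let D (N : ℕ) : Subgroup (FreeGroup Bool) :=
    ((Subgroup.zpowers (Multiplicative.ofAdd (1 / N : ℚ))).map transHom).comap e
  let K : Subgroup (FreeGroup Bool) := (transHom (χ := signedPowers u)).range.comap e
  obtain ⟨S, hS⟩ := hG.fg (K.map h)
  have hbound : ∀ g : G, ∃ N : ℕ, N ≠ 0 ∧ ∀ M : ℕ, M ≠ 0 → N ∣ M → g ∈ S → g ∈ (D M).map h := by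
    intro g
    by_cases hg : g ∈ S
    · have hg' : g ∈ K.map h := hS ▸ Subgroup.subset_closure hg
      obtain ⟨w, ⟨q, hq⟩, rfl⟩ := hg'
      refine ⟨q.toAdd.den, q.toAdd.den_nz, fun M hM hd _ => ⟨w, ⟨q, ?_, hq⟩, rfl⟩⟩
      obtain ⟨t, rfl⟩ := hd
      refine ⟨q.toAdd.num * t, ?_⟩
      show Multiplicative.ofAdd (1 / ((q.toAdd.den * t : ℕ) : ℚ)) ^ (q.toAdd.num * t) = q
      rw [← ofAdd_zsmul]
      apply Multiplicative.toAdd.injective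
      rw [toAdd_ofAdd, zsmul_eq_mul]
      have ht : (t : ℚ) ≠ 0 := by
        rintro h0
        simp_all
      have hden : (q.toAdd.den : ℚ) ≠ 0 := by exact_mod_cast q.toAdd.den_nz
      nth_rw 3 [← Rat.num_div_den q.toAdd]
      push_cast
      field_simp
    -- A dummy value that makes `N` total; only its values on `S` enter the product.
    · exact ⟨1, one_ne_zero, fun _ _ _ h => absurd h hg⟩
  choose N hN0 hN using hbound
  set M := ∏ g ∈ S, N g
  have hM0 : M ≠ 0 := Finset.prod_ne_zero_iff.mpr fun g _ => hN0 g
  have hle : K.map h ≤ (D M).map h := by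
    rw [← hS, Subgroup.closure_le]
    exact fun g hg => hN g M hM0 (Finset.dvd_prod_of_mem N hg) hg
  -- The inclusion of images under `h` lifts because `h.ker` lies in the kernel of `e`.
  have hKD : K ≤ D M := by
    intro w hw
    obtain ⟨w', hw', hww'⟩ := hle (Subgroup.mem_map_of_mem h hw)
    have h1 : e (w'⁻¹ * w) = 1 := hh (by rw [MonoidHom.mem_ker, map_mul, map_inv, hww',
      inv_mul_cancel])
    have h2 : e w = e w' := by rwa [map_mul, map_inv, inv_mul_eq_one, eq_comm] at h1
    rw [Subgroup.mem_comap, h2]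
    exact hw'
  set x : FreeGroup Bool := FreeGroup.of true
  set y : FreeGroup Bool := ⁅FreeGroup.of false, x⁆
  have hy : e y = transHom (Multiplicative.ofAdd (-1)) := by
    rw [map_commutatorElement, markHom_false, markHom_true, commutator_reflection_homothety, hu]
    norm_num
  -- The exponent is the common denominator `M` itself: `1 / 2^M` in `(1 / M)ℤ` would force `2^M ∣
  -- M`, whereas `M < 2^M`.
  have hconj : e ((x ^ M)⁻¹ * y * x ^ M) = transHom (Multiplicative.ofAdd (-(1 / 2 ^ M))) := by
    rw [map_mul, map_mul, hy, map_inv, map_pow, markHom_true, mul_assoc, inv_mul_eq_iff_eq_mul]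
    have h0 : (homothety u ^ M).trans = 0 := by
      generalize M = k
      induction k with
      | zero => rfl
      | succ k ih => rw [pow_succ, mul_trans, ih]; simp [homothety]
    ext : 1
    · rw [mul_trans, mul_trans, homothety_pow_lin, h0, hu]
      simp
    · simp
  obtain ⟨_, ⟨z, rfl⟩, hz⟩ := hKD (show _ ∈ K from ⟨_, hconj.symm⟩)
  have h5 := transHom_injective (hz.trans hconj)
  have h6 : (z : ℚ) * (1 / M) = -(1 / 2 ^ M) := by
    have := congrArg Multiplicative.toAdd h5
    simpa [← ofAdd_zsmul] using this
  have hMQ : (M : ℚ) ≠ 0 := by exact_mod_cast hM0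
  have h7 : -(z : ℚ) * 2 ^ M = M := by
    field_simp at h6
    linarith
  have h8 : -z * 2 ^ M = (M : ℤ) := by exact_mod_cast h7
  have h9 : M < 2 ^ M := Nat.lt_two_pow_self
  have h10 : (2 ^ M : ℕ) ∣ M := by
    zify
    exact ⟨-z, by rw [← h8]; ring⟩
  exact absurd (Nat.le_of_dvd (Nat.pos_of_ne_zero hM0) h10) (by omega)

end Subquotient

/-! ### The three bottom groups -/

theorem isLatticeByTwo_int : IsLatticeByTwo (Multiplicative ℤ) :=
  ⟨Unit, inferInstance, 0, 1, ℤ, inferInstance, inferInstance, inferInstance,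
    (1 : Multiplicative ℤ →* Unit).ker.subtype, by simp, Subgroup.subtype_injective _⟩

/-- The generator acts on `ℚ` as multiplication by 2. -/
theorem hasFaithfulRep_int : HasFaithfulRep (Multiplicative ℤ) := by
  refine ⟨ℚ, inferInstance, inferInstance, inferInstance, inferInstance,
    (Algebra.lmul ℚ ℚ).toMonoidHom.comp
      ((Units.coeHom ℚ).comp (zpowersHom ℚˣ (Units.mk0 2 two_ne_zero))), ?_⟩
  rw [injective_iff_map_eq_one]
  intro z hz
  have h1 := LinearMap.congr_fun hz 1
  have h2 : (2 : ℚ) ^ z.toAdd = 1 := by simpa using h1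
  have h3 : z.toAdd = 0 := by
    rw [← zpow_zero (2 : ℚ)] at h2
    exact zpow_right_injective₀ two_pos (by norm_num) h2
  exact Multiplicative.toAdd.injective h3

theorem isPolycyclic_zsqrtd (d : ℤ) : IsPolycyclic (Multiplicative (ℤ√d)) := by
  let f : ℤ →+ ℤ√d :=
    { toFun := fun z => ⟨0, z⟩, map_zero' := rfl, map_add' := fun _ _ => by ext <;> simp }
  let g : ℤ√d →+ ℤ :=
    { toFun := Zsqrtd.re, map_zero' := rfl, map_add' := fun _ _ => rfl }
  refine IsPolycyclic.of_extension (isPolycyclic_of_isCyclic (Multiplicative ℤ))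
    (isPolycyclic_of_isCyclic (Multiplicative ℤ)) (f := AddMonoidHom.toMultiplicative f)
    (g := AddMonoidHom.toMultiplicative g) (fun z z' h => congrArg (fun w => w.toAdd.im) h) ?_
  ext w
  rw [MonoidHom.mem_ker, MonoidHom.mem_range]
  constructor
  · intro h
    have hre : w.toAdd.re = 0 := h
    exact ⟨Multiplicative.ofAdd w.toAdd.im, Zsqrtd.ext hre.symm rfl⟩
  · rintro ⟨z, rfl⟩
    rfl

/-- The unit `1 + √2`. -/
def silverUnit : (ℤ√2)ˣ := ⟨⟨1, 1⟩, ⟨-1, 1⟩, rfl, rfl⟩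

theorem Lysionok.isSolvable_towerGroup {L : Type} [Group L] (hL : Group.IsSolvable L) (x s : L)
    (k : ℕ) : Group.IsSolvable (TowerGroup x s k) :=
  have := IterWreath.isSolvable hL (k + 1)
  Group.isSolvable_of_isSolvable_injective (Subgroup.subtype_injective _)

/-! ### The main theorem -/

open Lysionok AffineExtension

theorem proposition1 (n : ℕ) :
    (∃ (G : Type) (_ : Group G), IsTorsionBallQuotient n G ∧
      Infinite G ∧ IsVirtuallyAbelian G ∧
      (∃ A : Subgroup G, A.Normal ∧ IsFreeAbelian A ∧ ∃ k : ℕ, A.index = 2 ^ k) ∧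
      IsLinearGroup G) ∧
    (∃ (G : Type) (_ : Group G), IsTorsionBallQuotient n G ∧
      IsPolycyclic G ∧ ¬ Group.IsVirtuallyNilpotent G) ∧
    (∃ (G : Type) (_ : Group G), IsTorsionBallQuotient n G ∧
      ¬ IsPolycyclic G) := by
  have hcomm : Group.IsSolvable (Multiplicative ℤ × ℤˣ) := inferInstance
  refine ⟨?_, ?_, ?_⟩
  · have hlat := (isLatticeByTwo_int.iterWreath (3 * n + 3 + 1)).subgroup
      (towerHom (Multiplicative.ofAdd (1 : ℤ)) 1 (3 * n + 3)).range
    have hrep := (hasFaithfulRep_int.iterWreath (3 * n + 3 + 1)).subgroup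
      (towerHom (Multiplicative.ofAdd (1 : ℤ)) 1 (3 * n + 3)).range
    obtain ⟨h, hh⟩ := exists_subquotient (Multiplicative.ofAdd (1 : ℤ)) 1 (3 * n + 3)
    obtain ⟨A, hA, hfree, k, hk⟩ := hlat.exists_isFreeAbelian
    exact ⟨TowerGroup (Multiplicative.ofAdd (1 : ℤ)) 1 (3 * n + 3), inferInstance,
      isTorsionBallQuotient_tower (one_mul 1) n (isSolvable_towerGroup inferInstance _ _ _),
      infinite_of_subquotient hh,
      isVirtuallyAbelian_of_isFreeAbelian hfree (hk ▸ pow_ne_zero _ two_ne_zero),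
      ⟨A, hA, hfree, k, hk⟩, hrep.isLinearGroup⟩
  · obtain ⟨h, hh⟩ := exists_subquotient (homothety silverUnit) (reflection silverUnit) (3 * n + 3)
    have hpoly : IsPolycyclic (AffineExtension (signedPowers silverUnit)) :=
      AffineExtension.isPolycyclic (isPolycyclic_zsqrtd 2)
        ((isPolycyclic_of_isCyclic _).prod (isPolycyclic_of_isCyclic _))
    refine ⟨TowerGroup (homothety silverUnit) (reflection silverUnit) (3 * n + 3), inferInstance,
      isTorsionBallQuotient_tower (reflection_mul_self _) n
        (isSolvable_towerGroup (AffineExtension.isSolvable hcomm) _ _ _),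
      (IterWreath.isPolycyclic hpoly (3 * n + 3 + 1)).of_injective (Subgroup.subtype_injective _),
      not_isVirtuallyNilpotent_of_subquotient (Zsqrtd.toReal (d := 2) (by norm_num)) ?_ hh⟩
    -- The remaining goal is `1 < 1 + √2` in `ℝ`.
    simp [silverUnit, Zsqrtd.toReal]
  · let u : ℚˣ := Units.mk0 2 two_ne_zero
    obtain ⟨h, hh⟩ := exists_subquotient (homothety u) (reflection u) (3 * n + 3)
    exact ⟨TowerGroup (homothety u) (reflection u) (3 * n + 3), inferInstance,
      isTorsionBallQuotient_tower (reflection_mul_self _) n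
        (isSolvable_towerGroup (AffineExtension.isSolvable hcomm) _ _ _),
      not_isPolycyclic_of_subquotient rfl hh⟩
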